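/- A rooted strip triangulation is a triangulation of $S^1\times[0,1]$ in which every triangle has exactly one edge on the boundary (an up-triangle has it on the bottom circle, a down-triangle on the top circle), both circles carry finitely many, at least one, edges, and one up-triangle is marked as root. For $N\ge 1$ let $\mathbb{LT}_N$ be the set of rooted causal triangulations $\mathbf t=(\mathbf t(0),\dots,\mathbf t(N-1))$ of the torus: cyclic sequences of $N$ rooted strip triangulations such that the number of edges on the top circle of $\mathbf t(i)$ equals the number of edges on the bottom circle of $\mathbf t(i+1)$ for all $i$ modulo $N$, where consecutive strips are glued so that the top vertex of the root triangle of $\mathbf t(i)$ is the first bottom vertex of the root triangle of $\mathbf t(i+1)$. Regard $\mathbf t$ as a multigraph embedded in the torus (loops and multiple edges are allowed), let $\mathbf t^*$ be its dual multigraph, and let $n(\mathbf t)$ be the number of triangles. For a finite multigraph $G$ put $$Z_P(\beta,q,G)=\sum_{\sigma\in\{1,\dots,q\}^{V(G)}}\exp\Big(\beta\sum_{\langle x,y\rangle\in E(G)}\delta_{\sigma(x),\sigma(y)}\Big),$$ and define, with values in $(0,\infty]$, $$\Xi_N(\beta,\mu)=\sum_{\mathbf t\in\mathbb{LT}_N}e^{-\mu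 n(\mathbf t)}Z_P(\beta,q,\mathbf t),\qquad \Xi_N^*(\beta,\mu)=\sum_{\mathbf t\in\mathbb{LT}_N}e^{-\mu n(\mathbf t)}Z_P(\beta,q,\mathbf t^*).$$ **Theorem.** Let $q\ge 2$ be an integer, $\beta>0$, $\mu\in\mathbb R$, and $$\beta^*=\ln\Big(1+\frac{q}{e^\beta-1}\Big),\qquad \mu^*=\mu-\frac32\ln(e^\beta-1)+\ln q.$$ Then, for every $N\ge 1$, $$q^{-1}\,\Xi_N^*(\beta^*,\mu^*)\le \Xi_N(\beta,\mu)\le q\,\Xi_N^*(\beta^*,\mu^*).$$ Moreover, the free energies per strip coincide in the thermodynamic limit: $$\lim_{N\to\infty}\frac1N\ln\Xi_N(\beta,\mu)=\lim_{N\to\infty}\frac1N\ln\Xi_N^*(\beta^*,\mu^*)$$ in $[-\infty,\infty]$, in the sense that if one of the two limits exists then so does the other, and they are equal; in any case the two sequences have the same limit superior and the same limit inferior. -/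

import Mathlib

open Filter Topology
open scoped ENNReal

noncomputable section

/-! ### The Potts model on a finite multigraph -/

/-- A multigraph with vertex type `V` and edge type `E`; loops and parallel edges are allowed. -/
structure Multigraph (V E : Type) where
  /-- the unordered pair of end points of an edge -/
  ends : E → Sym2 V

namespace Multigraph

variable {V E : Type} [Fintype V] [DecidableEq V] [Fintype E]

/-- The `q`-state Potts Hamiltonian `h(σ) = - ∑_{⟨x,y⟩} δ_{σ(x),σ(y)}`, summed over all edges
(a loop always contributes `-1`, parallel edges contribute once each). -/
def hamiltonian (G : Multigraph V E) {q : ℕ} (σ : V → Fin q) : ℝ :=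
  -∑ e : E, if ((G.ends e).map σ).IsDiag then (1 : ℝ) else 0

/-- The `q`-state Potts partition function `Z_P(β, q, G) = ∑_σ exp (-β h(σ))`. -/
def pottsZ (G : Multigraph V E) (q : ℕ) (β : ℝ) : ℝ :=
  ∑ σ : V → Fin q, Real.exp (-β * G.hamiltonian σ)

end Multigraph

/-! ### Causal triangulations -/

/-- A rooted triangulation of a strip `S¹ × [i, i+1]` in which every triangle has exactly one edge
on the boundary. Such a triangulation is the cyclic sequence of its triangles, read
anticlockwise from the root triangle on: `true` stands for an up-triangle (its horizontal edge is
on the bottom circle), `false` for a down-triangle (its horizontal edge is on the top circle).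
The root triangle is an up-triangle, and both boundary circles have at least one edge. -/
structure Strip where
  word : List Bool
  root : word[0]? = some true
  top : false ∈ word

namespace Strip

/-- The number of triangles of the strip. -/
def size (s : Strip) : ℕ := s.word.length

/-- The number of triangles of kind `b` among the first `m` triangles. -/
def before (s : Strip) (b : Bool) (m : ℕ) : ℕ := Nat.count (fun j => s.word[j]? = some b) m

/-- The position in the sequence of the triangle number `k` of kind `b`
(numbering from `0`, meaningful when there are more than `k` of them). -/
def position (s : Strip) (b : Bool) (k : ℕ) : ℕ := Nat.nth (fun j => s.word[j]? = some b) k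

/-- The number of up-triangles, which is the number of edges on the bottom circle. -/
def nUp (s : Strip) : ℕ := s.before true s.size

/-- The number of down-triangles, which is the number of edges on the top circle. -/
def nDo (s : Strip) : ℕ := s.before false s.size

theorem size_pos (s : Strip) : 0 < s.size := by
  have h := s.root
  unfold size
  by_contra h0
  rw [List.getElem?_eq_none (by omega)] at h
  cases h

theorem nUp_pos (s : Strip) : 0 < s.nUp := by
  have h1 : Nat.count (fun j => s.word[j]? = some true) 1 = 1 := by
    simp [Nat.count_succ, s.root]
  have h2 := Nat.count_monotone (fun j => s.word[j]? = some true) s.size_pos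
  unfold nUp before
  simp only [Nat.succ_eq_add_one, zero_add] at h2
  omega

end Strip

/-- A rooted causal triangulation with `N` strips and periodic boundary condition: a sequence of
`N` strip triangulations, in which the top circle of each strip has as many edges as the bottom
circle of the next strip, the last strip being followed by the first (`finRotate N i` is `i + 1`
modulo `N`). Consecutive strips are glued so that the top vertex of the root triangle of a strip
is the bottom left vertex of the root triangle of the next strip; the result is a triangulated
torus, whose circle number `i` is the bottom of the strip number `i`. -/
@[ext] structure CausalTriangulation (N : ℕ) where
  strip : Fin N → Strip
  compat : ∀ i, (strip (finRotate N i)).nUp = (strip i).nDo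

namespace CausalTriangulation

variable {N : ℕ}

/-- The number `n(t)` of triangles. -/
def numTriangles (t : CausalTriangulation N) : ℕ := ∑ i, (t.strip i).size

/-- The vertices: on the circle number `i` they are numbered cyclically, from the bottom left vertex
of the root triangle of the strip number `i` on. -/
abbrev Vertex (t : CausalTriangulation N) : Type := (i : Fin N) × Fin (t.strip i).nUp

/-- The triangles: the strip they belong to, and their position in this strip. -/
abbrev Face (t : CausalTriangulation N) : Type := (i : Fin N) × Fin (t.strip i).size

/-- The edges. `Sum.inl ⟨i, k⟩` is the horizontal edge number `k` of the circle number `i`;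
`Sum.inr ⟨i, j⟩` is the edge inside the strip number `i` that is the left side of its triangle
number `j`. -/
abbrev Edge (t : CausalTriangulation N) : Type :=
  ((i : Fin N) × Fin (t.strip i).nUp) ⊕ ((i : Fin N) × Fin (t.strip i).size)

/-- The vertex number `m` (cyclically) of the circle number `i`. -/
def vertex (t : CausalTriangulation N) (i : Fin N) (m : ℕ) : t.Vertex :=
  ⟨i, ⟨m % (t.strip i).nUp, Nat.mod_lt _ (t.strip i).nUp_pos⟩⟩

/-- The triangle number `m` (cyclically) of the strip number `i`. -/
def face (t : CausalTriangulation N) (i : Fin N) (m : ℕ) : t.Face :=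
  ⟨i, ⟨m % (t.strip i).size, Nat.mod_lt _ (t.strip i).size_pos⟩⟩

/-- The causal triangulation as a multigraph. A horizontal edge joins cyclically consecutive
vertices of its circle. The left side of the triangle number `j` of a strip joins the bottom vertex
and the top vertex reached after the triangles to its left: each up-triangle advances the bottom
vertex by one, each down-triangle the top vertex. -/
def graph (t : CausalTriangulation N) : Multigraph t.Vertex t.Edge where
  ends
    | Sum.inl ⟨i, k⟩ => s(t.vertex i k, t.vertex i (k + 1))
    | Sum.inr ⟨i, j⟩ => s(t.vertex i ((t.strip i).before true j),
        t.vertex (finRotate N i) ((t.strip i).before false j))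

/-- The dual multigraph: its vertices are the triangles, and the dual of an edge joins the two
triangles abutting this edge. For the horizontal edge number `k` of a circle these are the
up-triangle number `k` of the strip above it and the down-triangle number `k` of the strip below it;
for the left side of the triangle number `j` of a strip these are this triangle and the preceding
one. -/
def dualGraph (t : CausalTriangulation N) : Multigraph t.Face t.Edge where
  ends
    | Sum.inl ⟨i, k⟩ => s(t.face i ((t.strip i).position true k),
        t.face ((finRotate N).symm i) ((t.strip ((finRotate N).symm i)).position false k))
    | Sum.inr ⟨i, j⟩ => s(t.face i j, t.face i (j + ((t.strip i).size - 1)))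

end CausalTriangulation

/-! ### The annealed models -/

/-- The partition function `Ξ_N(β, μ) = ∑_t exp (-μ n(t)) Z_P(β, q, t)` of the annealed `q`-state
Potts model coupled to causal triangulations with periodic boundary condition, as a sum of
positive terms with values in `[0, ∞]`. -/
def annealedZ (q N : ℕ) (β μ : ℝ) : ℝ≥0∞ :=
  ∑' t : CausalTriangulation N,
    ENNReal.ofReal (Real.exp (-μ * t.numTriangles) * t.graph.pottsZ q β)

/-- The partition function `Ξ*_N(β, μ) = ∑_t exp (-μ n(t)) Z_P(β, q, t*)` of the annealed `q`-state
Potts model coupled to dual causal triangulations. -/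
def annealedDualZ (q N : ℕ) (β μ : ℝ) : ℝ≥0∞ :=
  ∑' t : CausalTriangulation N,
    ENNReal.ofReal (Real.exp (-μ * t.numTriangles) * t.dualGraph.pottsZ q β)

/-- The free energy per strip `(1/N) ln Ξ_N(β, μ)`, with values in `[-∞, ∞]`. -/
def freeEnergy (q : ℕ) (β μ : ℝ) (N : ℕ) : EReal := ENNReal.log (annealedZ q N β μ) / (N : EReal)

/-- The free energy per strip `(1/N) ln Ξ*_N(β, μ)` of the dual model, with values in `[-∞, ∞]`. -/
def dualFreeEnergy (q : ℕ) (β μ : ℝ) (N : ℕ) : EReal :=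
  ENNReal.log (annealedDualZ q N β μ) / (N : EReal)

end

/-! With `v = e^β - 1`, the Fortuin–Kasteleyn expansion (`pottsZ_eq_sum`) is a sum of `v^|A| q^k(A)`
over edge sets `A`, where `k` counts components. The map `β ↦ β*` is `v ↦ q / v`, so passing from
`A` to the complementary dual edge set matches the two expansions term by term, up to the exponent
of `q`. For planar graphs Euler's formula makes the exponents agree exactly; on a torus
noncontractible cycles spoil this, but by at most one in either direction, hence the factor `q`.

The error bound comes from linear algebra over `ZMod 2`: the cut spaces of the triangulation and of
its dual are orthogonal (`CausalTriangulation.orthogonal`), so their dimensions satisfy an Euler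
inequality (`numComponents_compl_add_card_le`). Using it in both roles, with `|E| = |V| + |F|`,
gives the two bounds.

Since `|E| = 3m` and `|F| = 2m` with `m = |V|`, the remaining prefactors are absorbed by `μ*`
(`exp_dual_weight`). The factor `q` disappears from the free energy as `ln q / N → 0`. -/

namespace Multigraph

variable {V F E : Type}

/-! ### Components, cut spaces modulo 2 and the Euler inequality. -/

theorem exists_ends (G : Multigraph V E) (e : E) : ∃ x y, G.ends e = s(x, y) := by
  generalize G.ends e = z
  induction z using Sym2.ind with
  | _ x y => exact ⟨x, y, rfl⟩

/-- Two vertices are adjacent via `A` if they are the end points of an edge in `A`. -/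
def AdjVia (G : Multigraph V E) (A : Finset E) (x y : V) : Prop := ∃ e ∈ A, G.ends e = s(x, y)

/-- The number of connected components of the spanning subgraph with edge set `A`. -/
noncomputable def numComponents (G : Multigraph V E) (A : Finset E) : ℕ :=
  Nat.card (Quot (G.AdjVia A))

/-- A colouring is compatible with `A` if no edge of `A` joins vertices of different colours. -/
def Monochromatic {C : Type} (G : Multigraph V E) (A : Finset E) (σ : V → C) : Prop :=
  ∀ e ∈ A, ((G.ends e).map σ).IsDiag

theorem Monochromatic.eq_of_adjVia {C : Type} {G : Multigraph V E} {A : Finset E} {σ : V → C}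
    (h : G.Monochromatic A σ) {x y : V} (hxy : G.AdjVia A x y) : σ x = σ y := by
  obtain ⟨e, he, hxy⟩ := hxy
  simpa [hxy] using h e he

theorem monochromatic_comp_mk {C : Type} (G : Multigraph V E) (A : Finset E)
    (τ : Quot (G.AdjVia A) → C) : G.Monochromatic A (fun x => τ (Quot.mk _ x)) := by
  intro e he
  obtain ⟨x, y, hxy⟩ := G.exists_ends e
  rw [hxy]
  simpa using congrArg τ (Quot.sound ⟨e, he, hxy⟩)

/-- Colourings compatible with `A` are colourings of the connected components. -/
def monochromaticEquiv (C : Type) (G : Multigraph V E) (A : Finset E) :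
    {σ : V → C // G.Monochromatic A σ} ≃ (Quot (G.AdjVia A) → C) where
  toFun σ := Quot.lift σ.1 fun _ _ h => σ.2.eq_of_adjVia h
  invFun τ := ⟨fun x => τ (Quot.mk _ x), G.monochromatic_comp_mk A τ⟩
  left_inv _ := rfl
  right_inv τ := by
    funext x
    induction x using Quot.ind
    rfl

/-- Serves twice: with `q` colours in the Fortuin–Kasteleyn expansion, and with colours in `ZMod 2`
to turn the number of components into a dimension. -/
theorem card_monochromatic [Finite V] (C : Type) (G : Multigraph V E) (A : Finset E) :
    Nat.card {σ : V → C // G.Monochromatic A σ} = Nat.card C ^ G.numComponents A := by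
  have : Finite (Quot (G.AdjVia A)) := Quot.finite _
  rw [Nat.card_congr (G.monochromaticEquiv C A), Nat.card_fun, numComponents]

/-- The coboundary of a function on the vertices, modulo `2`. -/
def coboundary (G : Multigraph V E) : (V → ZMod 2) →ₗ[ZMod 2] (E → ZMod 2) where
  toFun f e := Sym2.lift ⟨fun x y => f x + f y, fun _ _ => add_comm _ _⟩ (G.ends e)
  map_add' f g := by
    funext e
    obtain ⟨x, y, hxy⟩ := G.exists_ends e
    simp only [hxy, Sym2.lift_mk, Pi.add_apply]
    ring
  map_smul' c f := by
    funext e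
    obtain ⟨x, y, hxy⟩ := G.exists_ends e
    simp only [hxy, Sym2.lift_mk, Pi.smul_apply, smul_eq_mul, RingHom.id_apply]
    ring

theorem coboundary_apply (G : Multigraph V E) (f : V → ZMod 2) {e : E} {x y : V}
    (h : G.ends e = s(x, y)) : G.coboundary f e = f x + f y := by
  simp [coboundary, h]

theorem coboundary_eq_zero_iff (G : Multigraph V E) (f : V → ZMod 2) (e : E) :
    G.coboundary f e = 0 ↔ ((G.ends e).map f).IsDiag := by
  obtain ⟨x, y, hxy⟩ := G.exists_ends e
  rw [G.coboundary_apply f hxy, CharTwo.add_eq_zero, hxy]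
  simp

/-- The coboundary, restricted to the edges in `A`. -/
def coboundaryOn (G : Multigraph V E) (A : Finset E) : (V → ZMod 2) →ₗ[ZMod 2] (A → ZMod 2) :=
  LinearMap.funLeft (ZMod 2) (ZMod 2) (fun e : A => (e : E)) ∘ₗ G.coboundary

theorem coboundaryOn_apply (G : Multigraph V E) (A : Finset E) (f : V → ZMod 2) (e : A) :
    G.coboundaryOn A f e = G.coboundary f e := rfl

theorem mem_ker_coboundaryOn (G : Multigraph V E) (A : Finset E) (f : V → ZMod 2) :
    f ∈ LinearMap.ker (G.coboundaryOn A) ↔ G.Monochromatic A f := by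
  simp [LinearMap.mem_ker, funext_iff, coboundaryOn_apply, Monochromatic, coboundary_eq_zero_iff]

theorem finrank_ker_coboundaryOn [Fintype V] (G : Multigraph V E) (A : Finset E) :
    Module.finrank (ZMod 2) (LinearMap.ker (G.coboundaryOn A)) = G.numComponents A := by
  have h1 : Nat.card (LinearMap.ker (G.coboundaryOn A)) = 2 ^ G.numComponents A := by
    rw [Nat.card_congr (Equiv.subtypeEquivRight (G.mem_ker_coboundaryOn A)),
      card_monochromatic, Nat.card_zmod]
  rw [Module.natCard_eq_pow_finrank (K := ZMod 2), Nat.card_zmod] at h1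
  exact Nat.pow_right_injective le_rfl h1

/-- Subspaces of `ιᵏ` that are orthogonal for the dot product have complementary dimensions at
most. -/
theorem finrank_add_finrank_le_card_of_dotProduct_eq_zero {K ι : Type} [Field K] [Fintype ι]
    (P R : Submodule K (ι → K)) (h : ∀ x ∈ P, ∀ y ∈ R, y ⬝ᵥ x = 0) :
    Module.finrank K P + Module.finrank K R ≤ Fintype.card ι := by
  classical
  have h1 := Subspace.finrank_add_finrank_dualAnnihilator_eq P
  have h2 : R.map (dotProductEquiv K ι).toLinearMap ≤ P.dualAnnihilator := by
    rintro _ ⟨y, hy, rfl⟩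
    rw [Submodule.mem_dualAnnihilator]
    intro x hx
    exact h x hx y hy
  have h3 := Submodule.finrank_mono h2
  rw [LinearEquiv.finrank_map_eq] at h3
  rw [Module.finrank_fintype_fun_eq_card] at h1
  omega

/-- The Euler type inequality between the numbers of components of a subgraph and of the dual
subgraph, for a pair of multigraphs with the same edges whose cut spaces are orthogonal. -/
theorem numComponents_compl_add_card_le [Fintype V] [Fintype F] [Fintype E] [DecidableEq E]
    (G : Multigraph V E) (H : Multigraph F E)
    (horth : ∀ f g, ∑ e, G.coboundary f e * H.coboundary g e = 0)
    (hconn : ∀ g, H.coboundary g = 0 → ∀ x y, g x = g y) (A : Finset E) :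
    H.numComponents Aᶜ + Fintype.card V ≤ A.card + G.numComponents A + 1 := by
  set Q := LinearMap.ker (H.coboundaryOn Aᶜ) with hQ
  have hvan : ∀ g ∈ Q, ∀ e ∉ A, H.coboundary g e = 0 := by
    intro g hg e he
    have := congrFun (LinearMap.mem_ker.1 hg) ⟨e, Finset.mem_compl.2 he⟩
    simpa [coboundaryOn_apply] using this
  -- An element of the kernel has zero coboundary on `A` and off `A`, so it is constant by `hconn`;
  -- evaluation at one vertex is then injective on the kernel.
  set T := (H.coboundaryOn A).domRestrict Q
  have hker : Module.finrank (ZMod 2) (LinearMap.ker T) ≤ 1 := by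
    rcases isEmpty_or_nonempty F with hF | ⟨⟨x₀⟩⟩
    · have : Subsingleton (LinearMap.ker T) := by
        constructor
        intro a b
        exact Subtype.ext (Subtype.ext (Subsingleton.elim _ _))
      rw [Module.finrank_zero_of_subsingleton]
      exact zero_le_one
    · have hinj : Function.Injective ((LinearMap.proj (R := ZMod 2) (φ := fun _ : F => ZMod 2) x₀ ∘ₗ
          Q.subtype) ∘ₗ (LinearMap.ker T).subtype) := by
        rw [injective_iff_map_eq_zero]
        rintro ⟨⟨g, hg⟩, hgT⟩ h0
        have hz : H.coboundary g = 0 := by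
          funext e
          by_cases he : e ∈ A
          · exact congrFun (LinearMap.mem_ker.1 hgT) ⟨e, he⟩
          · exact hvan g hg e he
        refine Subtype.ext (Subtype.ext (funext fun x => ?_))
        exact (hconn g hz x x₀).trans h0
      simpa using LinearMap.finrank_le_finrank_of_injective hinj
  have h1 := LinearMap.finrank_range_add_finrank_ker T
  have h2 := LinearMap.finrank_range_add_finrank_ker (G.coboundaryOn A)
  -- Coboundaries of elements of `Q` vanish off `A`, so orthogonality over all edges is
  -- orthogonality over `A`.
  have h3 := finrank_add_finrank_le_card_of_dotProduct_eq_zero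
    (LinearMap.range (G.coboundaryOn A)) (LinearMap.range T) (by
      rintro _ ⟨f, rfl⟩ _ ⟨⟨g, hg⟩, rfl⟩
      rw [← horth f g, ← Finset.sum_subset (Finset.subset_univ A)
        (fun e _ he => by rw [hvan g hg e he, mul_zero]), ← Finset.sum_coe_sort A]
      exact Finset.sum_congr rfl fun e _ => mul_comm _ _)
  have h4 := H.finrank_ker_coboundaryOn Aᶜ
  rw [← hQ] at h4
  rw [finrank_ker_coboundaryOn, Module.finrank_fintype_fun_eq_card] at h2
  rw [Fintype.card_coe] at h3
  omega

/-! ### Random cluster expansion and termwise duality. -/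

/-- The Fortuin–Kasteleyn expansion of the Potts partition function. -/
theorem pottsZ_eq_sum [Fintype V] [DecidableEq V] [Fintype E] (G : Multigraph V E) (q : ℕ) (β : ℝ) :
    G.pottsZ q β = ∑ A : Finset E, (Real.exp β - 1) ^ A.card * (q : ℝ) ^ G.numComponents A := by
  classical
  have hσ : ∀ σ : V → Fin q, Real.exp (-β * G.hamiltonian σ) =
      ∑ A : Finset E, if G.Monochromatic A σ then (Real.exp β - 1) ^ A.card else 0 := by
    intro σ
    have h1 : -β * G.hamiltonian σ =
        ∑ e : E, β * if ((G.ends e).map σ).IsDiag then (1 : ℝ) else 0 := by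
      rw [hamiltonian, neg_mul_neg, Finset.mul_sum]
    -- Each edge factor is `1 + v δ`; expanding the product selects the set `A` of edges that
    -- contribute `v δ`.
    have h2 : ∀ e : E, Real.exp (β * if ((G.ends e).map σ).IsDiag then (1 : ℝ) else 0) =
        1 + if ((G.ends e).map σ).IsDiag then Real.exp β - 1 else 0 := by
      intro e
      split_ifs <;> simp
    rw [h1, Real.exp_sum, Finset.prod_congr rfl fun e _ => h2 e, Finset.prod_one_add,
      Finset.powerset_univ]
    refine Finset.sum_congr rfl fun A _ => ?_
    by_cases hA : G.Monochromatic A σ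
    · rw [if_pos hA, Finset.prod_congr rfl fun e he => if_pos (hA e he), Finset.prod_const]
    · rw [if_neg hA]
      simp only [Monochromatic, not_forall] at hA
      obtain ⟨e, he, hne⟩ := hA
      exact Finset.prod_eq_zero he (if_neg hne)
  rw [pottsZ, Finset.sum_congr rfl fun σ _ => hσ σ, Finset.sum_comm]
  refine Finset.sum_congr rfl fun A _ => ?_
  have hc := G.card_monochromatic (Fin q) A
  rw [Nat.card_fin, Nat.card_eq_fintype_card, Fintype.card_subtype] at hc
  rw [← Finset.sum_filter, Finset.sum_const, hc, nsmul_eq_mul, mul_comm]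
  push_cast
  rfl

/-- One half of the approximate duality of the Potts partition function for the multigraphs of
a torus. -/
theorem pottsZ_le_of_dual [Fintype V] [DecidableEq V] [Fintype F] [DecidableEq F] [Fintype E]
    (G : Multigraph V E) (H : Multigraph F E) (q : ℕ) (hq : 1 ≤ q) (β β' : ℝ) (hβ : 0 < β)
    (hv : Real.exp β' - 1 = q / (Real.exp β - 1))
    (hnum : ∀ A : Finset E, ∀ B : Finset E, (∀ e, e ∈ B ↔ e ∉ A) →
      G.numComponents A + A.card ≤ H.numComponents B + Fintype.card V + 1) :
    (q : ℝ) ^ Fintype.card E * G.pottsZ q β ≤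
      q * (q : ℝ) ^ Fintype.card V * (Real.exp β - 1) ^ Fintype.card E * H.pottsZ q β' := by
  classical
  have hv0 : 0 < Real.exp β - 1 := by simpa using hβ
  have hq1 : (1 : ℝ) ≤ q := by exact_mod_cast hq
  have hq0 : (0 : ℝ) < q := by linarith
  rw [pottsZ_eq_sum, pottsZ_eq_sum, Finset.mul_sum, Finset.mul_sum,
    ← Equiv.sum_comp (Equiv.ofBijective (compl : Finset E → Finset E) compl_bijective)
      fun A => _ * ((Real.exp β' - 1) ^ A.card * (q : ℝ) ^ H.numComponents A)]
  refine Finset.sum_le_sum fun A _ => ?_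
  rw [Equiv.ofBijective_apply]
  have hA := Finset.card_add_card_compl A
  have hk := hnum A Aᶜ fun e => Finset.mem_compl
  rw [hv, div_pow, ← hA]
  set v := Real.exp β - 1
  have e1 : (q : ℝ) * q ^ Fintype.card V * v ^ (A.card + Aᶜ.card) *
      ((q : ℝ) ^ Aᶜ.card / v ^ Aᶜ.card * q ^ H.numComponents Aᶜ) =
      v ^ A.card * ((q : ℝ) ^ Aᶜ.card * q ^ (H.numComponents Aᶜ + Fintype.card V + 1)) := by
    rw [pow_add v]
    field_simp
    ring
  have e2 : (q : ℝ) ^ (A.card + Aᶜ.card) * (v ^ A.card * (q : ℝ) ^ G.numComponents A) =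
      v ^ A.card * ((q : ℝ) ^ Aᶜ.card * q ^ (G.numComponents A + A.card)) := by ring
  rw [e1, e2]
  -- Only the exponents of `q` differ; `hk` compares them, and `q ≥ 1` makes powers monotone.
  gcongr

end Multigraph

/-! ### Orthogonality and connectedness on the torus. -/

/-- Summing over the numbers of the elements of `p` below `n` is summing over these elements. -/
theorem sum_range_count_nth {M : Type} [AddCommMonoid M] (p : ℕ → Prop) [DecidablePred p] (n : ℕ)
    (φ : ℕ → ℕ → M) :
    ∑ k ∈ Finset.range (Nat.count p n), φ k (Nat.nth p k) =
      ∑ j ∈ Finset.range n, if p j then φ (Nat.count p j) j else 0 := by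
  induction n with
  | zero => simp
  | succ n ih =>
    rw [Finset.sum_range_succ _ n, ← ih, Nat.count_succ]
    split_ifs with h
    · rw [Finset.sum_range_succ, Nat.nth_count h]
    · simp

theorem sum_range_eq_sum_range_add_one {M : Type} [AddCommGroup M] (φ : ℕ → M) (n : ℕ)
    (h : φ n = φ 0) : ∑ j ∈ Finset.range n, φ j = ∑ j ∈ Finset.range n, φ (j + 1) := by
  have h1 := Finset.sum_range_succ φ n
  rw [Finset.sum_range_succ', h] at h1
  exact (add_right_cancel h1).symm

namespace Strip

theorem before_zero (s : Strip) (b : Bool) : s.before b 0 = 0 := Nat.count_zero _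

theorem before_succ (s : Strip) (b : Bool) (m : ℕ) :
    s.before b (m + 1) = s.before b m + if s.word[m]? = some b then 1 else 0 :=
  Nat.count_succ _ m

theorem nUp_add_nDo (s : Strip) : s.nUp + s.nDo = s.size := by
  have h : ∀ m ≤ s.size, s.before true m + s.before false m = m := by
    intro m
    induction m with
    | zero => simp [before_zero]
    | succ m ih =>
      intro hm
      have := ih (by omega)
      have hm' : m < s.word.length := hm
      rw [before_succ, before_succ, List.getElem?_eq_getElem hm']
      cases s.word[m] <;> simp <;> omega
  exact h _ le_rfl

/-- The identity behind the closedness of the boundaries of the triangles, summed over one strip: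
`a` and `c` are functions on the bottom and top circles, `g` is a function on the triangles. -/
theorem sum_coboundary_mul_eq_zero (s : Strip) (a c g : ℕ → ZMod 2)
    (ha : a s.nUp = a 0) (hc : c s.nDo = c 0) (hg : ∀ j, g (j + s.size) = g j) :
    ∑ k ∈ Finset.range s.nUp, (a k + a (k + 1)) * g (s.position true k) +
      ∑ k ∈ Finset.range s.nDo, (c k + c (k + 1)) * g (s.position false k) +
      ∑ j ∈ Finset.range s.size,
        (a (s.before true j) + c (s.before false j)) * (g j + g (j + (s.size - 1))) = 0 := by
  have hpos := s.size_pos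
  have h1 : ∀ (b : Bool) (d : ℕ → ZMod 2), ∑ k ∈ Finset.range (s.before b s.size),
      (d k + d (k + 1)) * g (s.position b k) = ∑ j ∈ Finset.range s.size,
        if s.word[j]? = some b then (d (s.before b j) + d (s.before b j + 1)) * g j else 0 :=
    fun b d => sum_range_count_nth (fun j => s.word[j]? = some b) s.size
      (fun k j => (d k + d (k + 1)) * g j)
  -- The right side of a triangle is the left side of the next one; a cyclic shift collects all
  -- terms at the triangle where `g` is evaluated.
  have h2 : ∑ j ∈ Finset.range s.size,
        (a (s.before true j) + c (s.before false j)) * g (j + (s.size - 1)) =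
      ∑ j ∈ Finset.range s.size,
        (a (s.before true (j + 1)) + c (s.before false (j + 1))) * g j := by
    rw [sum_range_eq_sum_range_add_one]
    · refine Finset.sum_congr rfl fun j _ => ?_
      rw [show j + 1 + (s.size - 1) = j + s.size by omega, hg]
    · change (a s.nUp + c s.nDo) * _ = _
      rw [ha, hc, before_zero, before_zero, add_comm s.size, hg, zero_add]
  simp only [mul_add, Finset.sum_add_distrib]
  rw [h2, nUp, nDo, h1, h1, ← Finset.sum_add_distrib, ← Finset.sum_add_distrib,
    ← Finset.sum_add_distrib]
  -- The coefficient of `g j` is now the sum of the coboundary over the three sides of triangle `j`,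
  -- where each corner occurs twice.
  refine Finset.sum_eq_zero fun j hj => ?_
  have hj' : j < s.word.length := Finset.mem_range.1 hj
  rw [before_succ, before_succ, List.getElem?_eq_getElem hj']
  have h22 : (2 : ZMod 2) = 0 := rfl
  cases s.word[j]
  · simp
    linear_combination ((a (s.before true j) + c (s.before false j)) * g j +
      c (s.before false j + 1) * g j) * h22
  · simp
    linear_combination ((a (s.before true j) + c (s.before false j)) * g j +
      a (s.before true j + 1) * g j) * h22

end Strip

namespace CausalTriangulation

variable {N : ℕ}

theorem vertex_eq_of_mod_eq (t : CausalTriangulation N) (i : Fin N) {k l : ℕ}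
    (h : k % (t.strip i).nUp = l % (t.strip i).nUp) : t.vertex i k = t.vertex i l := by
  unfold vertex
  simp only [h]

theorem face_eq_of_mod_eq (t : CausalTriangulation N) (i : Fin N) {k l : ℕ}
    (h : k % (t.strip i).size = l % (t.strip i).size) : t.face i k = t.face i l := by
  unfold face
  simp only [h]

theorem vertex_val (t : CausalTriangulation N) (i : Fin N) (k : Fin (t.strip i).nUp) :
    t.vertex i k = ⟨i, k⟩ := by
  unfold vertex
  simp only [Nat.mod_eq_of_lt k.2]

theorem face_val (t : CausalTriangulation N) (i : Fin N) (k : Fin (t.strip i).size) :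
    t.face i k = ⟨i, k⟩ := by
  unfold face
  simp only [Nat.mod_eq_of_lt k.2]

/-- Regrouped by triangles, the sum weights each `g`-value with the sum of a coboundary around a
closed triangle, which is zero. -/
theorem orthogonal (t : CausalTriangulation N) (f : t.Vertex → ZMod 2) (g : t.Face → ZMod 2) :
    ∑ e, t.graph.coboundary f e * t.dualGraph.coboundary g e = 0 := by
  have hl : ∀ (i : Fin N) (k : Fin (t.strip i).nUp),
      t.graph.coboundary f (Sum.inl ⟨i, k⟩) * t.dualGraph.coboundary g (Sum.inl ⟨i, k⟩) =
      (f (t.vertex i k) + f (t.vertex i (k + 1))) * g (t.face i ((t.strip i).position true k)) +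
      (f (t.vertex i k) + f (t.vertex i (k + 1))) * g (t.face ((finRotate N).symm i)
          ((t.strip ((finRotate N).symm i)).position false k)) := fun i k => by
    rw [t.graph.coboundary_apply f rfl, t.dualGraph.coboundary_apply g rfl, mul_add]
  have hr : ∀ (i : Fin N) (j : Fin (t.strip i).size),
      t.graph.coboundary f (Sum.inr ⟨i, j⟩) * t.dualGraph.coboundary g (Sum.inr ⟨i, j⟩) =
      (f (t.vertex i ((t.strip i).before true j)) +
        f (t.vertex (finRotate N i) ((t.strip i).before false j))) *
        (g (t.face i j) + g (t.face i (j + ((t.strip i).size - 1)))) := fun i j => by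
    rw [t.graph.coboundary_apply f rfl, t.dualGraph.coboundary_apply g rfl]
  rw [Fintype.sum_sum_type, Fintype.sum_sigma, Fintype.sum_sigma]
  simp only [hl, hr, Finset.sum_add_distrib]
  -- Down-triangles on a circle lie in the strip below; the shift assigns their terms to that strip.
  rw [← Equiv.sum_comp (finRotate N) (fun i => ∑ k : Fin (t.strip i).nUp,
    (f (t.vertex i k) + f (t.vertex i (k + 1))) * g (t.face ((finRotate N).symm i)
          ((t.strip ((finRotate N).symm i)).position false k)))]
  rw [← Finset.sum_add_distrib, ← Finset.sum_add_distrib]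
  refine Finset.sum_eq_zero fun i _ => ?_
  rw [← (t.strip i).sum_coboundary_mul_eq_zero (fun k => f (t.vertex i k))
    (fun k => f (t.vertex (finRotate N i) k)) (fun j => g (t.face i j))
    (congrArg f (t.vertex_eq_of_mod_eq i (by simp)))
    (congrArg f (t.vertex_eq_of_mod_eq _ (by simp [← t.compat i])))
    (fun j => congrArg g (t.face_eq_of_mod_eq i (by simp))),
    ← t.compat i, Finset.sum_range, Finset.sum_range, Finset.sum_range]
  simp only [Equiv.symm_apply_apply]

theorem eq_of_finRotate {α : Type} (a : Fin N → α) (h : ∀ i, a (finRotate N i) = a i)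
    (i j : Fin N) : a i = a j := by
  obtain _ | n := N
  · exact i.elim0
  have h0 : ∀ i, a i = a 0 := by
    intro i
    induction i using Fin.induction with
    | zero => rfl
    | succ i ih =>
      rw [← ih, ← h i.castSucc, finRotate_apply, Fin.coeSucc_eq_succ]
  rw [h0 i, h0 j]

theorem graph_connected (t : CausalTriangulation N) (f : t.Vertex → ZMod 2)
    (hf : t.graph.coboundary f = 0) (x y : t.Vertex) : f x = f y := by
  have hl : ∀ (i : Fin N) (k : ℕ), k < (t.strip i).nUp →
      f (t.vertex i k) = f (t.vertex i (k + 1)) := fun i k hk => by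
    have h := congrFun hf (Sum.inl ⟨i, ⟨k, hk⟩⟩)
    rw [t.graph.coboundary_apply f rfl] at h
    exact CharTwo.add_eq_zero.1 h
  have hc : ∀ (i : Fin N) (k : ℕ), k ≤ (t.strip i).nUp → f (t.vertex i k) = f (t.vertex i 0) := by
    intro i k
    induction k with
    | zero => exact fun _ => rfl
    | succ k ih => exact fun hk => (hl i k hk).symm.trans (ih (by omega))
  -- The left side of the root triangle joins the vertices numbered `0` of consecutive circles.
  have hr : ∀ i : Fin N, f (t.vertex (finRotate N i) 0) = f (t.vertex i 0) := fun i => by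
    have h := congrFun hf (Sum.inr ⟨i, ⟨0, (t.strip i).size_pos⟩⟩)
    rw [t.graph.coboundary_apply f rfl] at h
    have h' := CharTwo.add_eq_zero.1 h
    simpa [Strip.before_zero] using h'.symm
  obtain ⟨i, k⟩ := x
  obtain ⟨j, l⟩ := y
  rw [← t.vertex_val i k, ← t.vertex_val j l, hc i k k.2.le, hc j l l.2.le]
  exact eq_of_finRotate (fun i => f (t.vertex i 0)) hr i j

theorem dualGraph_connected (t : CausalTriangulation N) (g : t.Face → ZMod 2)
    (hg : t.dualGraph.coboundary g = 0) (x y : t.Face) : g x = g y := by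
  have hl : ∀ (i : Fin N) (k : ℕ), k + 1 < (t.strip i).size →
      g (t.face i (k + 1)) = g (t.face i k) := fun i k hk => by
    have h := congrFun hg (Sum.inr ⟨i, ⟨k + 1, hk⟩⟩)
    rw [t.dualGraph.coboundary_apply g rfl] at h
    have h' := CharTwo.add_eq_zero.1 h
    rw [show (⟨k + 1, hk⟩ : Fin (t.strip i).size).val + ((t.strip i).size - 1) =
      k + (t.strip i).size by dsimp only; omega] at h'
    rwa [t.face_eq_of_mod_eq i (Nat.add_mod_right k (t.strip i).size)] at h'
  have hc : ∀ (i : Fin N) (k : ℕ), k < (t.strip i).size → g (t.face i k) = g (t.face i 0) := by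
    intro i k
    induction k with
    | zero => exact fun _ => rfl
    | succ k ih => exact fun hk => (hl i k hk).trans (ih (by omega))
  -- `face` reduces its index cyclically, so no bound on `position` is needed below.
  have hc' : ∀ (i : Fin N) (k : ℕ), g (t.face i k) = g (t.face i 0) := fun i k => by
    rw [← hc i _ (Nat.mod_lt k (t.strip i).size_pos)]
    exact congrArg g (t.face_eq_of_mod_eq i (Nat.mod_mod _ _).symm)
  have hr : ∀ i : Fin N, g (t.face (finRotate N i) 0) = g (t.face i 0) := fun i => by
    have h := congrFun hg (Sum.inl ⟨finRotate N i, ⟨0, Strip.nUp_pos _⟩⟩)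
    rw [t.dualGraph.coboundary_apply g rfl] at h
    have h' := CharTwo.add_eq_zero.1 h
    rw [hc', Equiv.symm_apply_apply, hc' i] at h'
    exact h'
  obtain ⟨i, k⟩ := x
  obtain ⟨j, l⟩ := y
  rw [← t.face_val i k, ← t.face_val j l, hc i k k.2, hc j l l.2]
  exact eq_of_finRotate (fun i => g (t.face i 0)) hr i j

/-! ### Euler characteristic zero and duality for one triangulation. -/

theorem card_face (t : CausalTriangulation N) : Fintype.card t.Face = t.numTriangles := by
  simp [numTriangles]

/-- Euler's relation for the torus, built into the indexing: each vertex starts one horizontal edge,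
and each triangle has one left side. -/
theorem card_edge (t : CausalTriangulation N) :
    Fintype.card t.Edge = Fintype.card t.Vertex + Fintype.card t.Face :=
  Fintype.card_sum

/-- Every horizontal edge borders one up-triangle and one down-triangle. -/
theorem card_face_eq_two_mul (t : CausalTriangulation N) :
    Fintype.card t.Face = 2 * Fintype.card t.Vertex := by
  have h : ∑ i, (t.strip i).nDo = ∑ i, (t.strip i).nUp := by
    rw [← Equiv.sum_comp (finRotate N) fun i => (t.strip i).nUp]
    exact Finset.sum_congr rfl fun i _ => (t.compat i).symm
  simp only [Fintype.card_sigma, Fintype.card_fin, ← Strip.nUp_add_nDo, Finset.sum_add_distrib, h]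
  ring

end CausalTriangulation

namespace CausalTriangulation

variable {N : ℕ}

theorem pottsZ_graph_le (t : CausalTriangulation N) (q : ℕ) (hq : 1 ≤ q) (β β' : ℝ) (hβ : 0 < β)
    (hv : Real.exp β' - 1 = q / (Real.exp β - 1)) :
    (q : ℝ) ^ Fintype.card t.Edge * t.graph.pottsZ q β ≤
      q * (q : ℝ) ^ Fintype.card t.Vertex * (Real.exp β - 1) ^ Fintype.card t.Edge *
        t.dualGraph.pottsZ q β' := by
  classical
  refine t.graph.pottsZ_le_of_dual t.dualGraph q hq β β' hβ hv fun A B hAB => ?_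
  obtain rfl : A = Bᶜ := by
    ext e
    rw [Finset.mem_compl, hAB, not_not]
  -- The roles are exchanged: an upper bound on the components of the primal subgraph is wanted, so
  -- the dual graph comes first. `card_edge` then trades `|F|` for `|V|`.
  have h := t.dualGraph.numComponents_compl_add_card_le t.graph
    (fun g f => by simpa only [mul_comm] using t.orthogonal f g) t.graph_connected B
  have h1 := Finset.card_add_card_compl B
  have h2 := t.card_edge
  omega

theorem pottsZ_dualGraph_le (t : CausalTriangulation N) (q : ℕ) (hq : 1 ≤ q) (β β' : ℝ)
    (hβ : 0 < β) (hv : Real.exp β' - 1 = q / (Real.exp β - 1)) :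
    (q : ℝ) ^ Fintype.card t.Edge * t.dualGraph.pottsZ q β ≤
      q * (q : ℝ) ^ Fintype.card t.Face * (Real.exp β - 1) ^ Fintype.card t.Edge *
        t.graph.pottsZ q β' := by
  classical
  refine t.dualGraph.pottsZ_le_of_dual t.graph q hq β β' hβ hv fun A B hAB => ?_
  obtain rfl : A = Bᶜ := by
    ext e
    rw [Finset.mem_compl, hAB, not_not]
  have h := t.graph.numComponents_compl_add_card_le t.dualGraph t.orthogonal
    t.dualGraph_connected B
  have h1 := Finset.card_add_card_compl B
  have h2 := t.card_edge
  omega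

end CausalTriangulation

/-! ### Summation over triangulations. -/

/-- The relation between the weights of a triangulation with `2 m` triangles in the two models. -/
theorem exp_dual_weight (q : ℕ) (hq : 1 ≤ q) (β μ μ' : ℝ) (hβ : 0 < β)
    (hμ' : μ' = μ - 3 / 2 * Real.log (Real.exp β - 1) + Real.log (q : ℝ)) (m : ℕ) :
    Real.exp (-μ' * (2 * m : ℕ)) * (q : ℝ) ^ (2 * m) =
      Real.exp (-μ * (2 * m : ℕ)) * (Real.exp β - 1) ^ (3 * m) := by
  have hv0 : 0 < Real.exp β - 1 := by simpa using hβ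
  have hq0 : (0 : ℝ) < q := by exact_mod_cast hq
  have h : -μ' * (2 * m : ℕ) = -μ * (2 * m : ℕ) +
      ((3 * m : ℕ) * Real.log (Real.exp β - 1) - (2 * m : ℕ) * Real.log q) := by
    rw [hμ']
    push_cast
    ring
  rw [h, Real.exp_add, Real.exp_sub, Real.exp_nat_mul, Real.exp_nat_mul, Real.exp_log hv0,
    Real.exp_log hq0]
  field_simp

theorem annealedZ_le (q N : ℕ) (hq : 1 ≤ q) (β μ β' μ' : ℝ) (hβ : 0 < β)
    (hv : Real.exp β' - 1 = q / (Real.exp β - 1))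
    (hμ' : μ' = μ - 3 / 2 * Real.log (Real.exp β - 1) + Real.log (q : ℝ)) :
    annealedZ q N β μ ≤ q * annealedDualZ q N β' μ' := by
  have hq0 : (0 : ℝ) < q := by exact_mod_cast hq
  rw [annealedZ, annealedDualZ, ← ENNReal.tsum_mul_left]
  refine ENNReal.tsum_le_tsum fun t => ?_
  rw [← ENNReal.ofReal_natCast q, ← ENNReal.ofReal_mul hq0.le]
  refine ENNReal.ofReal_le_ofReal ?_
  have h1 := t.pottsZ_graph_le q hq β β' hβ hv
  have h2 := exp_dual_weight q hq β μ μ' hβ hμ' (Fintype.card t.Vertex)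
  rw [t.card_edge, t.card_face_eq_two_mul] at h1
  rw [← t.card_face, t.card_face_eq_two_mul]
  set m := Fintype.card t.Vertex
  rw [show m + 2 * m = 3 * m by ring] at h1
  refine le_of_mul_le_mul_left ?_ (pow_pos hq0 (3 * m))
  calc (q : ℝ) ^ (3 * m) * (Real.exp (-μ * (2 * m : ℕ)) * t.graph.pottsZ q β)
      = Real.exp (-μ * (2 * m : ℕ)) * ((q : ℝ) ^ (3 * m) * t.graph.pottsZ q β) := by ring
    _ ≤ Real.exp (-μ * (2 * m : ℕ)) *
        (q * (q : ℝ) ^ m * (Real.exp β - 1) ^ (3 * m) * t.dualGraph.pottsZ q β') := by gcongr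
    _ = q * (q : ℝ) ^ m * (Real.exp (-μ * (2 * m : ℕ)) * (Real.exp β - 1) ^ (3 * m)) *
        t.dualGraph.pottsZ q β' := by ring
    _ = _ := by rw [← h2]; ring

theorem annealedDualZ_le (q N : ℕ) (hq : 1 ≤ q) (β μ β' μ' : ℝ) (hβ : 0 < β)
    (hv : Real.exp β' - 1 = q / (Real.exp β - 1))
    (hμ' : μ' = μ - 3 / 2 * Real.log (Real.exp β - 1) + Real.log (q : ℝ)) :
    annealedDualZ q N β' μ' ≤ q * annealedZ q N β μ := by
  have hq0 : (0 : ℝ) < q := by exact_mod_cast hq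
  have hv0 : 0 < Real.exp β - 1 := by simpa using hβ
  have hβ' : 0 < β' := by
    have h : 0 < Real.exp β' - 1 := hv ▸ div_pos hq0 hv0
    simpa using h
  -- The relation `v v* = q` is symmetric, so the dual bound applies with the two temperatures
  -- exchanged.
  have hv' : Real.exp β - 1 = q / (Real.exp β' - 1) := by
    rw [hv, div_div_cancel₀ hq0.ne']
  rw [annealedZ, annealedDualZ, ← ENNReal.tsum_mul_left]
  refine ENNReal.tsum_le_tsum fun t => ?_
  rw [← ENNReal.ofReal_natCast q, ← ENNReal.ofReal_mul hq0.le]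
  refine ENNReal.ofReal_le_ofReal ?_
  have h1 := t.pottsZ_dualGraph_le q hq β' β hβ' hv'
  have h2 := exp_dual_weight q hq β μ μ' hβ hμ' (Fintype.card t.Vertex)
  rw [t.card_edge, t.card_face_eq_two_mul, hv] at h1
  rw [← t.card_face, t.card_face_eq_two_mul]
  set m := Fintype.card t.Vertex
  rw [show m + 2 * m = 3 * m by ring] at h1
  -- The factor `q^(2m)` is consumed by the weight relation `h2`, and `q^(3m)` by the Potts bound
  -- `h1`.
  refine le_of_mul_le_mul_left ?_ (pow_pos hq0 (2 * m + 3 * m))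
  calc (q : ℝ) ^ (2 * m + 3 * m) * (Real.exp (-μ' * (2 * m : ℕ)) * t.dualGraph.pottsZ q β')
      = Real.exp (-μ' * (2 * m : ℕ)) * (q : ℝ) ^ (2 * m) *
        ((q : ℝ) ^ (3 * m) * t.dualGraph.pottsZ q β') := by ring
    _ ≤ Real.exp (-μ' * (2 * m : ℕ)) * (q : ℝ) ^ (2 * m) *
        (q * (q : ℝ) ^ (2 * m) * (q / (Real.exp β - 1)) ^ (3 * m) * t.graph.pottsZ q β) := by
      gcongr
    _ = _ := by
      rw [h2, div_pow]
      field_simp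
      ring

/-! ### Passage to the thermodynamic limit. -/

/-- The limits superior and inferior are monotone up to an error that tends to `0`. -/
theorem EReal.limsup_le_and_liminf_le_of_le_add {u v ε : ℕ → EReal}
    (hε : Tendsto ε atTop (𝓝 0)) (h : ∀ᶠ n in atTop, u n ≤ v n + ε n) :
    limsup u atTop ≤ limsup v atTop ∧ liminf u atTop ≤ liminf v atTop := by
  have h0 : limsup ε atTop = 0 := hε.limsup_eq
  -- Finiteness of the error's limit rules out `∞ - ∞`, so `u` and `v` may take infinite values.
  have h1 : limsup ε atTop ≠ ⊤ := by simp [h0]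
  have h2 : limsup ε atTop ≠ ⊥ := by simp [h0]
  constructor
  · refine (limsup_le_limsup h).trans ?_
    have := EReal.limsup_add_le (u := v) (v := ε) (f := atTop) (.inr h1) (.inr h2)
    rwa [h0, add_zero] at this
  · refine (liminf_le_liminf h).trans ?_
    have := EReal.liminf_add_le (u := ε) (v := v) (f := atTop) (.inl h2) (.inl h1)
    rwa [h0, zero_add, add_comm ε v] at this

theorem log_div_natCast_le {q : ℕ} (hq : 1 ≤ q) {x y : ℝ≥0∞} (h : x ≤ q * y) (N : ℕ) :
    ENNReal.log x / (N : EReal) ≤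
      ENNReal.log y / (N : EReal) + ((Real.log q / N : ℝ) : EReal) := by
  have hq0 : (0 : ℝ) < q := by exact_mod_cast hq
  have hN : (0 : EReal) ≤ N := by positivity
  have h1 := ENNReal.log_le_log h
  rw [ENNReal.log_mul_add, ← ENNReal.ofReal_natCast q, ENNReal.log_ofReal_of_pos hq0, add_comm] at h1
  refine (EReal.div_le_div_right_of_nonneg hN h1).trans_eq ?_
  rw [EReal.add_div_of_nonneg_right hN, EReal.coe_div]
  rfl

theorem tendsto_coe_div_natCast_atTop (c : ℝ) :
    Tendsto (fun N : ℕ => ((c / N : ℝ) : EReal)) atTop (𝓝 0) := by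
  rw [← EReal.coe_zero, EReal.tendsto_coe]
  exact tendsto_const_div_atTop_nhds_zero_nat c

theorem theorem1 (q : ℕ) (hq : 2 ≤ q) (β μ β' μ' : ℝ) (hβ : 0 < β)
    (hβ' : β' = Real.log (1 + (q : ℝ) / (Real.exp β - 1)))
    (hμ' : μ' = μ - 3 / 2 * Real.log (Real.exp β - 1) + Real.log (q : ℝ)) :
    (∀ N : ℕ, 1 ≤ N →
      (q : ℝ≥0∞)⁻¹ * annealedDualZ q N β' μ' ≤ annealedZ q N β μ ∧
        annealedZ q N β μ ≤ (q : ℝ≥0∞) * annealedDualZ q N β' μ') ∧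
    (∀ ℓ : EReal, Tendsto (freeEnergy q β μ) atTop (𝓝 ℓ) ↔
      Tendsto (dualFreeEnergy q β' μ') atTop (𝓝 ℓ)) ∧
    limsup (freeEnergy q β μ) atTop = limsup (dualFreeEnergy q β' μ') atTop ∧
    liminf (freeEnergy q β μ) atTop = liminf (dualFreeEnergy q β' μ') atTop := by
  have hq1 : 1 ≤ q := by omega
  have hq0 : (0 : ℝ) < q := by exact_mod_cast hq1
  have hv0 : 0 < Real.exp β - 1 := by simpa using hβ
  have hv : Real.exp β' - 1 = q / (Real.exp β - 1) := by
    rw [hβ', Real.exp_log (by positivity)]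
    ring
  have hle := fun N => annealedZ_le q N hq1 β μ β' μ' hβ hv hμ'
  have hge := fun N => annealedDualZ_le q N hq1 β μ β' μ' hβ hv hμ'
  have hε := tendsto_coe_div_natCast_atTop (Real.log q)
  obtain ⟨hs1, hi1⟩ := EReal.limsup_le_and_liminf_le_of_le_add (u := freeEnergy q β μ)
    (v := dualFreeEnergy q β' μ') hε (.of_forall fun N => log_div_natCast_le hq1 (hle N) N)
  obtain ⟨hs2, hi2⟩ := EReal.limsup_le_and_liminf_le_of_le_add (u := dualFreeEnergy q β' μ')
    (v := freeEnergy q β μ) hε (.of_forall fun N => log_div_natCast_le hq1 (hge N) N)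
  have hs := le_antisymm hs1 hs2
  have hi := le_antisymm hi1 hi2
  refine ⟨fun N _ => ⟨?_, hle N⟩, fun ℓ => ⟨fun h => ?_, fun h => ?_⟩, hs, hi⟩
  · rw [mul_comm, ← div_eq_mul_inv]
    exact ENNReal.div_le_of_le_mul' (hge N)
  -- Convergence in `EReal` means equality of both limits, which the two models share.
  · exact tendsto_of_liminf_eq_limsup (hi ▸ h.liminf_eq) (hs ▸ h.limsup_eq)
  · exact tendsto_of_liminf_eq_limsup (hi ▸ h.liminf_eq) (hs ▸ h.limsup_eq)
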